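/- Let $D=(d_1\ge d_2\ge\dots\ge d_n)$ be the degree sequence of a tree, i.e. there is a tree on $n$ vertices whose vertex degrees, listed with multiplicity in nonincreasing order, are $d_1,\dots,d_n$. The greedy tree $G(D)$ is the tree with vertices $v_1,\dots,v_n$ constructed as follows: $v_1$ is the root, and its children are the next $d_1$ vertices $v_2,\dots,v_{d_1+1}$; then, successively for $i=2,3,\dots,n$, the children of $v_i$ are the first $d_i-1$ vertices (in the order $v_1,v_2,\dots,v_n$) that are neither the root nor children of any of $v_1,\dots,v_{i-1}$; each vertex is joined by an edge to each of its children. For a finite graph $G$, let the incidence energy $\mathrm{IE}(G)$ be the sum of the singular values of its (unoriented) vertex-edge incidence matrix, and let $\mathrm{LEL}(G)=\sum_{i}\sqrt{\mu_i}$, where the $\mu_i$ are the eigenvalues, with multiplicity, of its Laplacian matrix (diagonal degree matrix minus adjacency matrix). Then $G(D)$ is a tree with degree sequence $D$, and for every tree $T$ with degree sequence $D$ we have $\mathrm{IE}(T)=\mathrm{LEL}(T)$, \[ \mathrm{IE}(G(D))\le \mathrm{IE}(T)\qquad\text{and}\qquad \mathrm{LEL}(G(D))\le \mathrm{LEL}(T).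 \] -/

import Mathlib

namespace GreedyTree

/-- The list `D` is the degree sequence of the finite graph `G`: it is nonincreasing and lists the
degrees of the vertices of `G` with multiplicity. -/
def HasDegreeSequence {V : Type*} [Fintype V] (G : SimpleGraph V) [DecidableRel G.Adj]
    (D : List ℕ) : Prop :=
  D.Pairwise (· ≥ ·) ∧ (D : Multiset ℕ) = Finset.univ.val.map fun v : V => G.degree v

/-- `D` is the degree sequence of some tree. -/
def IsTreeDegreeSequence (D : List ℕ) : Prop :=
  ∃ (n : ℕ) (G : SimpleGraph (Fin n)) (_ : DecidableRel G.Adj), G.IsTree ∧ HasDegreeSequence G D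

/-- The number of children of the `i`-th labelled vertex in the greedy algorithm: all neighbours of
the root `0` are children, and every other vertex has exactly one neighbour that is not a child. -/
def childCount (D : List ℕ) (i : ℕ) : ℕ :=
  if i = 0 then D.getD 0 0 else D.getD i 0 - 1

/-- In the greedy algorithm the vertices are labelled `0, 1, 2, …` in order of appearance, and
the `i`-th labelled vertex is assigned the `i`-th largest degree, namely the entry of index `i` of
the nonincreasing list `D`. `labelledCount D i` is the number of vertices labelled before it is
the turn of vertex `i` to have its children labelled: at the start only the root is labelled,
and each vertex adds its children. -/
def labelledCount (D : List ℕ) : ℕ → ℕ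
  | 0 => 1
  | i + 1 => labelledCount D i + childCount D i

/-- `j` is a child of `i`: it is one of the first `childCount D i` labels that are
still unused when it is the turn of vertex `i`. -/
def IsChild (D : List ℕ) (i j : ℕ) : Prop :=
  labelledCount D i ≤ j ∧ j < labelledCount D i + childCount D i

instance (D : List ℕ) (i j : ℕ) : Decidable (IsChild D i j) :=
  inferInstanceAs (Decidable (_ ∧ _))

/-- The greedy tree of the nonincreasing degree sequence `D`: the output of the greedy algorithm,
which processes the vertices in order of their labels and joins every vertex to its children. -/
def greedyTree (D : List ℕ) : SimpleGraph (Fin D.length) where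
  Adj i j := i ≠ j ∧ (IsChild D i j ∨ IsChild D j i)
  symm := ⟨fun _ _ h => ⟨h.1.symm, h.2.symm⟩⟩
  loopless := ⟨fun _ h => h.1 rfl⟩

instance (D : List ℕ) : DecidableRel (greedyTree D).Adj :=
  fun i j => inferInstanceAs (Decidable (i ≠ j ∧ (IsChild D i j ∨ IsChild D j i)))

/-- The (unoriented) vertex-edge incidence matrix, with one column for each edge of `G`. -/
def incidenceMatrix {V : Type*} [DecidableEq V] (G : SimpleGraph V) [DecidableRel G.Adj] :
    Matrix V G.edgeSet ℝ :=
  (G.incMatrix ℝ).submatrix id Subtype.val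

/-- The incidence energy: the sum of the singular values (with multiplicity) of the vertex-edge
incidence matrix. -/
noncomputable def incidenceEnergy {V : Type*} [Fintype V] [DecidableEq V] (G : SimpleGraph V)
    [DecidableRel G.Adj] : ℝ :=
  (Matrix.toEuclideanLin (incidenceMatrix G)).singularValues.sum fun _ s => s

/-- The Laplacian-energy-like invariant: the sum of the square roots of the eigenvalues (with
multiplicity) of the Laplacian matrix. -/
noncomputable def laplacianEnergyLike {V : Type*} [Fintype V] [DecidableEq V] (G : SimpleGraph V)
    [DecidableRel G.Adj] : ℝ :=
  ∑ i, √((G.isHermitian_lapMatrix ℝ).eigenvalues i)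

end GreedyTree

/-! ### Singular values, the signless Laplacian and the Laplacian spectrum -/

section Spectral

open Matrix Polynomial

/-! For bipartite graphs the signless Laplacian is similar to the Laplacian, so `IE = LEL`. Since √a
is a fixed positive multiple of the integral of log(1 + a/t²) over t > 0, it suffices to show that
the greedy tree minimizes det(tI + L) for every t > 0.

This determinant is that of the matrix with diagonal `y v = d v + t` and off-diagonal part minus the
adjacency matrix. Perturb t to excess weights strictly decreasing in the label, and take a minimizer
among the finitely many trees with labelled degrees `d`. By
`IsMinimalRealization.det_add_single_lt`, smaller labels have smaller diagonal entries of the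
inverse; otherwise moving branches between two vertices and swapping their labels would lower the
determinant. By `IsMinimalRealization.not_det_add_single_lt`, the ends of a path are then ordered
consistently; otherwise exchanging two branches would lower it.

The resulting property `IsExchangeOrdered` forces labels to decrease towards the root and parents to
be monotone in their children. This determines the tree: it is the greedy one
(`IsExchangeOrdered.eq_greedyTree`). Letting the perturbation tend to zero gives the inequality. -/

theorem Matrix.sum_singularValues_toEuclideanLin {m n : Type*} [Fintype m] [DecidableEq m]
    [Fintype n] [DecidableEq n] (B : Matrix m n ℝ) :
    ((toEuclideanLin B).singularValues.sum fun _ s => s) =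
      ((B * Bᵀ).charpoly.roots.map Real.sqrt).sum := by
  have hchar : (LinearMap.adjoint (toEuclideanLin B) ∘ₗ toEuclideanLin B).charpoly =
      (Bᵀ * B).charpoly := by
    rw [← toEuclideanLin_conjTranspose_eq_adjoint, conjTranspose_eq_transpose_of_trivial]
    change (toLpLin 2 2 Bᵀ ∘ₗ toLpLin 2 2 B).charpoly = _
    rw [toLpLin_eq_toLin, toLpLin_eq_toLin, ← Matrix.toLin_mul, Matrix.charpoly_toLin]
  have hroots : (Bᵀ * B).charpoly.roots.map Real.sqrt = Finset.univ.val.map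
      (fun i : Fin (Module.finrank ℝ (EuclideanSpace ℝ n)) =>
        (toEuclideanLin B).singularValues i) := by
    rw [← hchar, LinearMap.IsSymmetric.roots_charpoly_eq_eigenvalues
      (LinearMap.isSymmetric_adjoint_comp_self _) rfl, Multiset.map_map]
    refine Multiset.map_congr rfl fun i _ => ?_
    rw [LinearMap.singularValues_fin _ rfl]
    rfl
  -- The two products have different sizes, so their characteristic polynomials agree only up to
  -- powers of X; the extra zero roots contribute √0 = 0.
  have hcomm := congrArg (fun p : ℝ[X] => (p.roots.map Real.sqrt).sum)
    (Matrix.charpoly_mul_comm' B Bᵀ)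
  rw [roots_mul (mul_ne_zero (pow_ne_zero _ X_ne_zero) (charpoly_monic _).ne_zero),
    roots_mul (mul_ne_zero (pow_ne_zero _ X_ne_zero) (charpoly_monic _).ne_zero)] at hcomm
  simp only [roots_X_pow, Multiset.map_add, Multiset.sum_add, Multiset.map_nsmul,
    Multiset.map_singleton, Real.sqrt_zero, Multiset.sum_nsmul, Multiset.sum_singleton,
    smul_zero, zero_add] at hcomm
  rw [hcomm, hroots, Finsupp.sum_of_support_subset (s := Finset.range
    (Module.finrank ℝ (EuclideanSpace ℝ n))) _ _ _ (fun _ _ => rfl), ← Fin.sum_univ_eq_sum_range]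
  · rfl
  · intro i hi
    by_contra h
    exact (Finsupp.mem_support_iff.1 hi)
      (LinearMap.singularValues_of_finrank_le _ (by simpa using h))

namespace GreedyTree

theorem laplacianEnergyLike_eq_sum_roots {V : Type*} [Fintype V] [DecidableEq V]
    (G : SimpleGraph V) [DecidableRel G.Adj] :
    laplacianEnergyLike G = ((G.lapMatrix ℝ).charpoly.roots.map Real.sqrt).sum := by
  rw [(G.isHermitian_lapMatrix ℝ).roots_charpoly_eq_eigenvalues, Multiset.map_map]
  rfl

theorem incidenceMatrix_mul_transpose {V : Type*} [Fintype V] [DecidableEq V]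
    (G : SimpleGraph V) [DecidableRel G.Adj] :
    incidenceMatrix G * (incidenceMatrix G)ᵀ =
      of fun a b => if a = b then (G.degree a : ℝ) else if G.Adj a b then 1 else 0 := by
  rw [← G.incMatrix_mul_transpose (R := ℝ)]
  ext a b
  have key : ∀ f : Sym2 V → ℝ, (∀ e ∉ G.edgeSet, f e = 0) → ∑ e : G.edgeSet, f e = ∑ e, f e := by
    intro f hf
    rw [← Finset.sum_subtype G.edgeFinset (by simp) f]
    exact Finset.sum_subset (Finset.subset_univ _) fun e _ he => hf e (by simpa using he)
  simp only [mul_apply, transpose_apply]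
  refine key (fun e => G.incMatrix ℝ a e * G.incMatrix ℝ b e) fun e he => ?_
  rw [G.incMatrix_of_notMem_incidenceSet fun h => he (G.incidenceSet_subset a h), zero_mul]

/-- Conjugating the Laplacian by the ±1 diagonal matrix of a bipartition flips the sign of every
off-diagonal entry. -/
theorem charpoly_incidenceMatrix_mul_transpose {V : Type*} [Fintype V] [DecidableEq V]
    (G : SimpleGraph V) [DecidableRel G.Adj] (hG : G.IsBipartite) :
    (incidenceMatrix G * (incidenceMatrix G)ᵀ).charpoly = (G.lapMatrix ℝ).charpoly := by
  obtain ⟨c⟩ := hG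
  let s : V → ℝ := fun v => if c v = 0 then 1 else -1
  have hs : ∀ v, s v * s v = 1 := fun v => by by_cases h : c v = 0 <;> simp [s, h]
  have hadj : ∀ v w, G.Adj v w → s v * s w = -1 := by
    intro v w h
    have := c.valid h
    have h1 : ∀ a b : Fin 2, a ≠ b →
        (if a = 0 then (1 : ℝ) else -1) * (if b = 0 then 1 else -1) = -1 := by
      intro a b hab
      fin_cases a <;> fin_cases b <;> simp at hab ⊢
    exact h1 _ _ this
  have hS : diagonal s * diagonal s = 1 := by
    rw [diagonal_mul_diagonal]; simp [hs]
  have : incidenceMatrix G * (incidenceMatrix G)ᵀ =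
      diagonal s * (G.lapMatrix ℝ * diagonal s) := by
    rw [incidenceMatrix_mul_transpose]
    ext a b
    simp only [of_apply, diagonal_mul, mul_diagonal, SimpleGraph.lapMatrix, Matrix.sub_apply,
      SimpleGraph.degMatrix, diagonal_apply, SimpleGraph.adjMatrix_apply]
    split_ifs with h h' h'
    · subst h; exact absurd h' (G.loopless.irrefl _)
    · subst h; linear_combination -(G.degree a : ℝ) * hs a
    · linear_combination hadj a b h'
    · simp
  rw [this, charpoly_mul_comm, Matrix.mul_assoc, hS, Matrix.mul_one]

theorem incidenceEnergy_eq_laplacianEnergyLike {V : Type*} [Fintype V] [DecidableEq V]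
    (G : SimpleGraph V) [DecidableRel G.Adj] (hG : G.IsBipartite) :
    incidenceEnergy G = laplacianEnergyLike G := by
  rw [incidenceEnergy, sum_singularValues_toEuclideanLin,
    charpoly_incidenceMatrix_mul_transpose G hG, laplacianEnergyLike_eq_sum_roots]

theorem det_smul_one_add_lapMatrix {V : Type*} [Fintype V] [DecidableEq V]
    (G : SimpleGraph V) [DecidableRel G.Adj] (t : ℝ) :
    (diagonal (fun _ => t) + G.lapMatrix ℝ).det =
      ∏ i, (t + (G.isHermitian_lapMatrix ℝ).eigenvalues i) := by
  have h1 := eval_charpoly (G.lapMatrix ℝ) (-t)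
  rw [(G.isHermitian_lapMatrix ℝ).charpoly_eq, eval_prod] at h1
  have h2 : diagonal (fun _ => t) + G.lapMatrix ℝ = -(scalar V (-t) - G.lapMatrix ℝ) := by
    ext a b
    by_cases h : a = b <;> simp [h, add_comm]
  rw [h2, det_neg, ← h1, ← Finset.card_univ, ← Finset.prod_const, ← Finset.prod_mul_distrib]
  refine Finset.prod_congr rfl fun i _ => ?_
  simp [add_comm]

end GreedyTree

end Spectral
-- Square roots as logarithmic integrals
section SqrtIntegral

open MeasureTheory Set

/-- Near 0 the integrand is log(1 + t²) − 2 log t; beyond 1 it is at most t⁻². -/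
theorem integrableOn_log_one_add_inv_sq :
    IntegrableOn (fun t : ℝ => Real.log (1 + (t ^ 2)⁻¹)) (Ioi 0) := by
  rw [← Ioc_union_Ioi_eq_Ioi zero_le_one, integrableOn_union]
  constructor
  · have h1 : IntegrableOn (fun t : ℝ => Real.log (1 + t ^ 2) - 2 * Real.log t) (Ioc 0 1) := by
      refine Integrable.sub ?_ (Integrable.const_mul ?_ 2)
      · refine ContinuousOn.integrableOn_Icc (a := 0) (b := 1) ?_ |>.mono_set Ioc_subset_Icc_self
        refine ContinuousOn.log (by fun_prop) fun x _ => by positivity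
      · exact (intervalIntegral.intervalIntegrable_log' (a := 0) (b := 1)).1
    refine h1.congr_fun (fun t ht => ?_) measurableSet_Ioc
    have ht0 : 0 < t := ht.1
    have : 1 + (t ^ 2)⁻¹ = (1 + t ^ 2) / t ^ 2 := by field_simp; ring
    simp only
    rw [this, Real.log_div (by positivity) (by positivity), Real.log_pow]
    norm_num
  · have h1 : IntegrableOn (fun t : ℝ => t ^ (-2 : ℝ)) (Ioi 1) :=
      integrableOn_Ioi_rpow_of_lt (by norm_num) one_pos
    refine h1.mono' ?_ ?_
    · exact (Measurable.aestronglyMeasurable (by fun_prop))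
    · filter_upwards [ae_restrict_mem measurableSet_Ioi] with t ht
      have ht0 : (0 : ℝ) < t := one_pos.trans ht
      have hp : 0 < (t ^ 2)⁻¹ := by positivity
      rw [Real.norm_eq_abs, abs_of_nonneg (Real.log_nonneg (by linarith)), Real.rpow_neg ht0.le,
        Real.rpow_two]
      linarith [Real.log_le_sub_one_of_pos (show 0 < 1 + (t ^ 2)⁻¹ by positivity)]

/-- Only the sign of this constant matters: it is cancelled at the end of the comparison. -/
theorem integral_log_one_add_inv_sq_pos :
    0 < ∫ t in Ioi (0 : ℝ), Real.log (1 + (t ^ 2)⁻¹) := by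
  rw [setIntegral_pos_iff_support_of_nonneg_ae _ integrableOn_log_one_add_inv_sq]
  · have : Ioi (0 : ℝ) ⊆ (Function.support fun t : ℝ => Real.log (1 + (t ^ 2)⁻¹)) ∩ Ioi 0 := by
      intro t ht
      have ht0 : (0 : ℝ) < t := ht
      have hp : 0 < (t ^ 2)⁻¹ := by positivity
      exact ⟨(Real.log_pos (by linarith)).ne', ht⟩
    exact lt_of_lt_of_le (by simp) (measure_mono this)
  · filter_upwards with t
    have hp : 0 ≤ (t ^ 2)⁻¹ := by positivity
    exact Real.log_nonneg (by linarith)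

theorem integrableOn_log_one_add_div_sq {a : ℝ} (ha : 0 ≤ a) :
    IntegrableOn (fun t : ℝ => Real.log (1 + a / t ^ 2)) (Ioi 0) := by
  rcases ha.eq_or_lt with rfl | ha
  · simp
  have hs : 0 < (√a)⁻¹ := by positivity
  have := (integrableOn_Ioi_comp_mul_left_iff (fun t : ℝ => Real.log (1 + (t ^ 2)⁻¹)) 0 hs).2
    (by simpa using integrableOn_log_one_add_inv_sq)
  refine this.congr_fun (fun t _ => ?_) measurableSet_Ioi
  simp only [mul_pow, inv_pow, Real.sq_sqrt ha.le, mul_inv, inv_inv, div_eq_mul_inv]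

/-- Rescaling t by √a pulls the square root out as the Jacobian. -/
theorem integral_log_one_add_div_sq {a : ℝ} (ha : 0 ≤ a) :
    ∫ t in Ioi (0 : ℝ), Real.log (1 + a / t ^ 2) =
      √a * ∫ t in Ioi (0 : ℝ), Real.log (1 + (t ^ 2)⁻¹) := by
  rcases ha.eq_or_lt with rfl | ha
  · simp
  have hs : 0 < (√a)⁻¹ := by positivity
  have := integral_comp_mul_left_Ioi (fun t : ℝ => Real.log (1 + (t ^ 2)⁻¹)) 0 hs
  rw [mul_zero, inv_inv, smul_eq_mul] at this
  rw [← this]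
  refine setIntegral_congr_fun measurableSet_Ioi (fun t _ => ?_)
  simp only [mul_pow, inv_pow, Real.sq_sqrt ha.le, mul_inv, inv_inv, div_eq_mul_inv]

theorem sum_log_one_add_div_sq {ι : Type*} [Fintype ι] {a : ι → ℝ} (ha : ∀ i, 0 ≤ a i) {t : ℝ}
    (ht : 0 < t) : ∑ i, Real.log (1 + a i / t ^ 2) =
      Real.log (∏ i, (t ^ 2 + a i)) - Fintype.card ι * Real.log (t ^ 2) := by
  have hpos : ∀ i, 0 < t ^ 2 + a i := fun i => by have := ha i; positivity
  rw [Real.log_prod (fun i _ => (hpos i).ne'), ← nsmul_eq_mul, ← Finset.card_univ,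
    ← Finset.sum_const, ← Finset.sum_sub_distrib]
  refine Finset.sum_congr rfl fun i _ => ?_
  rw [← Real.log_div (hpos i).ne' (by positivity)]
  congr 1
  field_simp

/-- The sums of logarithms are log ∏(t² + aᵢ) minus a multiple of log t²; equal cardinalities make
the subtracted terms agree, so the integrands compare pointwise. -/
theorem sum_sqrt_le_sum_sqrt_of_prod_le {ι κ : Type*} [Fintype ι] [Fintype κ]
    (hcard : Fintype.card ι = Fintype.card κ) {a : ι → ℝ} {b : κ → ℝ} (ha : ∀ i, 0 ≤ a i)
    (hb : ∀ i, 0 ≤ b i) (h : ∀ t > 0, ∏ i, (t + a i) ≤ ∏ i, (t + b i)) :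
    ∑ i, √(a i) ≤ ∑ i, √(b i) := by
  have hle : ∫ t in Ioi (0 : ℝ), ∑ i, Real.log (1 + a i / t ^ 2) ≤
      ∫ t in Ioi (0 : ℝ), ∑ i, Real.log (1 + b i / t ^ 2) := by
    refine setIntegral_mono_on (integrable_finsetSum _ fun i _ =>
      integrableOn_log_one_add_div_sq (ha i)) (integrable_finsetSum _ fun i _ =>
      integrableOn_log_one_add_div_sq (hb i)) measurableSet_Ioi fun t ht => ?_
    have ht0 : (0 : ℝ) < t := ht
    rw [sum_log_one_add_div_sq ha ht0, sum_log_one_add_div_sq hb ht0, hcard]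
    have hpos : 0 < ∏ i, (t ^ 2 + a i) :=
      Finset.prod_pos fun i _ => by have := ha i; positivity
    linarith [Real.log_le_log hpos (h (t ^ 2) (by positivity))]
  rw [integral_finsetSum _ fun i _ => integrableOn_log_one_add_div_sq (ha i),
    integral_finsetSum _ fun i _ => integrableOn_log_one_add_div_sq (hb i)] at hle
  simp only [integral_log_one_add_div_sq, ha, hb, ← Finset.sum_mul] at hle
  exact le_of_mul_le_mul_right hle integral_log_one_add_inv_sq_pos

namespace GreedyTree

theorem laplacianEnergyLike_le_of_det_le {V W : Type*} [Fintype V] [DecidableEq V] [Fintype W]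
    [DecidableEq W] (G : SimpleGraph V) [DecidableRel G.Adj] (H : SimpleGraph W)
    [DecidableRel H.Adj] (hcard : Fintype.card V = Fintype.card W)
    (h : ∀ t > 0, (Matrix.diagonal (fun _ => t) + G.lapMatrix ℝ).det ≤
      (Matrix.diagonal (fun _ => t) + H.lapMatrix ℝ).det) :
    laplacianEnergyLike G ≤ laplacianEnergyLike H := by
  refine sum_sqrt_le_sum_sqrt_of_prod_le hcard (G.posSemidef_lapMatrix ℝ).eigenvalues_nonneg
    (H.posSemidef_lapMatrix ℝ).eigenvalues_nonneg fun t ht => ?_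
  rw [← det_smul_one_add_lapMatrix, ← det_smul_one_add_lapMatrix]
  exact h t ht

end GreedyTree

end SqrtIntegral

/-! ### Determinants under low-rank changes of a positive definite matrix -/

section RankUpdate

open Matrix

variable {V : Type*} [Fintype V] [DecidableEq V]

/-- The **Weinstein–Aronszajn identity** for the perturbation of an invertible matrix by a bilinear
combination of a finite family of vectors. -/
theorem Matrix.det_eq_of_eq_add_sum {k : Type*} [Fintype k] [DecidableEq k] {M N : Matrix V V ℝ}
    (hM : IsUnit M.det) (b : k → V → ℝ) (W P : Matrix k k ℝ)
    (hP : ∀ i j, b i ⬝ᵥ M⁻¹ *ᵥ b j = P i j)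
    (hN : ∀ x y, N x y = M x y + ∑ i, ∑ j, b i x * W i j * b j y) :
    N.det = M.det * (1 + W * P).det := by
  let U : Matrix V k ℝ := of fun v i => b i v
  have h : N = M + U * (W * Uᵀ) := by
    ext x y
    rw [hN, Matrix.add_apply]
    simp only [U, mul_apply, of_apply, transpose_apply, Finset.mul_sum, mul_assoc]
  have hPU : P = Uᵀ * (M⁻¹ * U) := by
    ext i j
    rw [← hP]
    rfl
  rw [h, det_add_mul _ _ hM, hPU]
  simp only [Matrix.mul_assoc]

theorem Matrix.PosDef.inv_apply_mul_inv_apply_pos {M : Matrix V V ℝ} (hM : M.PosDef) {u w : V}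
    (huw : u ≠ w) : 0 < M⁻¹ u u * M⁻¹ w w - M⁻¹ u w * M⁻¹ w u := by
  have h := (hM.inv.submatrix (e := ![u, w]) (by
    intro a b; fin_cases a <;> fin_cases b <;> simp [huw, huw.symm])).det_pos
  rw [det_fin_two] at h
  simpa using h

theorem Matrix.PosDef.inv_apply_comm {M : Matrix V V ℝ} (hM : M.PosDef) (u w : V) :
    M⁻¹ u w = M⁻¹ w u := by
  simpa using (hM.isHermitian.inv.apply w u)

theorem Matrix.diagonal_single_apply_eq_mul {V : Type*} [DecidableEq V] (v : V) (d : ℝ)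
    (x y : V) :
    diagonal (Pi.single v d) x y =
      d * ((Pi.single v 1 : V → ℝ) x * (Pi.single v 1 : V → ℝ) y) := by
  by_cases hx : x = v <;> by_cases hy : y = v <;> simp [diagonal_apply, hx, hy]
  rintro rfl
  exact absurd rfl hy

theorem Matrix.single_one_apply_eq_mul {V : Type*} [DecidableEq V] (v w x y : V) :
    single v w (1 : ℝ) x y = (Pi.single v 1 : V → ℝ) x * (Pi.single w 1 : V → ℝ) y := by
  simp only [single_apply, Pi.single_apply, eq_comm (a := v), eq_comm (a := w)]
  split_ifs <;> simp_all

/-- If the diagonal entry of the inverse at `u` is at least the one at `w`, then relocating a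
pendant part `ρ` from `u` to `w`, together with more than its total conductance on the diagonal,
decreases the determinant. -/
theorem Matrix.PosDef.det_relocate_lt {M : Matrix V V ℝ} (hM : M.PosDef) {u w : V} (huw : u ≠ w)
    {ρ : V → ℝ} (hu : (M⁻¹ *ᵥ ρ) u = 0) (hw : (M⁻¹ *ᵥ ρ) w = 0) {c : ℝ}
    (hc : ρ ⬝ᵥ M⁻¹ *ᵥ ρ < c)
    (hle : (M - (vecMulVec (Pi.single u 1) ρ + vecMulVec ρ (Pi.single u 1))
        + diagonal (Pi.single w 1)).det ≤
      (M - (vecMulVec (Pi.single u 1) ρ + vecMulVec ρ (Pi.single u 1))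
        + diagonal (Pi.single u 1)).det) :
    (M - (vecMulVec (Pi.single w 1) ρ + vecMulVec ρ (Pi.single w 1))
        + diagonal (Pi.single w c) - diagonal (Pi.single u c)).det <
      (M - (vecMulVec (Pi.single u 1) ρ + vecMulVec ρ (Pi.single u 1))).det := by
  have hK := hM.det_pos
  have hm := hM.inv_apply_mul_inv_apply_pos huw
  have hr : M⁻¹ w u = M⁻¹ u w := hM.inv_apply_comm w u
  have hcol : ∀ v, ρ ⬝ᵥ M⁻¹.col v = (M⁻¹ *ᵥ ρ) v := by
    intro v
    rw [dotProduct_comm]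
    exact Finset.sum_congr rfl fun x _ => by rw [col_apply, hM.inv_apply_comm]
  set g := ρ ⬝ᵥ M⁻¹ *ᵥ ρ with hg
  -- All four matrices differ from `M` by a bilinear form in these three vectors, whose Gram matrix
  -- under `M⁻¹` splits off `ρ` by `hu` and `hw`.
  let b : Fin 3 → V → ℝ := ![Pi.single u 1, Pi.single w 1, ρ]
  have hP : ∀ i j, b i ⬝ᵥ M⁻¹ *ᵥ b j =
      !![M⁻¹ u u, M⁻¹ u w, 0; M⁻¹ u w, M⁻¹ w w, 0; 0, 0, g] i j := by
    intro i j
    fin_cases i <;> fin_cases j <;> simp [b, hu, hw, hr, hcol, hg]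
  have hdet := fun W N => det_eq_of_eq_add_sum (N := N) hK.ne'.isUnit b W _ hP
  have h0 := hdet !![0, 0, -1; 0, 0, 0; -1, 0, 0]
    (M - (vecMulVec (Pi.single u 1) ρ + vecMulVec ρ (Pi.single u 1))) (by
      intro x y
      simp [Fin.sum_univ_three, b, vecMulVec_apply]; ring)
  have h1 := hdet !![1, 0, -1; 0, 0, 0; -1, 0, 0]
    (M - (vecMulVec (Pi.single u 1) ρ + vecMulVec ρ (Pi.single u 1))
      + diagonal (Pi.single u 1)) (by
      intro x y
      simp [Fin.sum_univ_three, b, vecMulVec_apply, diagonal_single_apply_eq_mul]; ring)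
  have h2 := hdet !![0, 0, -1; 0, 1, 0; -1, 0, 0]
    (M - (vecMulVec (Pi.single u 1) ρ + vecMulVec ρ (Pi.single u 1))
      + diagonal (Pi.single w 1)) (by
      intro x y
      simp [Fin.sum_univ_three, b, vecMulVec_apply, diagonal_single_apply_eq_mul]; ring)
  have h3 := hdet !![-c, 0, 0; 0, c, -1; 0, -1, 0]
    (M - (vecMulVec (Pi.single w 1) ρ + vecMulVec ρ (Pi.single w 1))
        + diagonal (Pi.single w c) - diagonal (Pi.single u c)) (by
      intro x y
      simp [Fin.sum_univ_three, b, vecMulVec_apply, diagonal_single_apply_eq_mul]; ring)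
  simp only [det_fin_three] at h0 h1 h2 h3
  simp at h0 h1 h2 h3
  rw [h1, h2] at hle
  rw [h0, h3]
  have hle' := le_of_mul_le_mul_left hle hK
  refine mul_lt_mul_of_pos_left ?_ hK
  rw [hr] at hm
  -- With α, β the diagonal entries of `M⁻¹` at `u`, `w` and m the 2×2 minor, `hle'` says β − α ≤
  -- g·m and the goal is (c − g)(β − α − c·m) < 0.
  nlinarith [mul_pos (sub_pos.2 hc) hm, mul_pos (sub_pos.2 hc) (mul_pos (sub_pos.2 hc) hm)]

theorem det_one_add_mul_pendant_pair (a b p q r s t z z' : ℝ) :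
    (1 + !![s, -1, 0, 0; -1, z, 0, 0; 0, 0, z', -1; 0, 0, -1, t] *
      !![a, 0, 0, 0; 0, p, r, 0; 0, r, q, 0; 0, 0, 0, b]).det =
      (1 + s * a) * (1 + t * b) + ((1 + s * a) * z - a) * (1 + t * b) * p
        + ((1 + t * b) * z' - b) * (1 + s * a) * q
        + ((1 + s * a) * z - a) * ((1 + t * b) * z' - b) * (p * q - r * r) := by
  simp [det_succ_row_zero, Fin.sum_univ_succ, one_apply, Fin.succAbove]
  ring

/-- The determinant after attaching two pendant parts, at `w` and `u`, by their vertices `i` and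
`j`, and adding weights on the diagonal. -/
theorem Matrix.PosDef.det_attach_pair {M : Matrix V V ℝ} (hM : M.PosDef) {i w u j : V}
    (hiw : M⁻¹ i w = 0) (hiu : M⁻¹ i u = 0) (hij : M⁻¹ i j = 0)
    (hjw : M⁻¹ j w = 0) (hju : M⁻¹ j u = 0) (s z z' t : ℝ) :
    (M - (single w i 1 + single i w 1 + single u j 1 + single j u 1) + diagonal (Pi.single i s)
        + diagonal (Pi.single w z) + diagonal (Pi.single u z') + diagonal (Pi.single j t)).det =
      M.det * ((1 + s * M⁻¹ i i) * (1 + t * M⁻¹ j j)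
        + ((1 + s * M⁻¹ i i) * z - M⁻¹ i i) * (1 + t * M⁻¹ j j) * M⁻¹ w w
        + ((1 + t * M⁻¹ j j) * z' - M⁻¹ j j) * (1 + s * M⁻¹ i i) * M⁻¹ u u
        + ((1 + s * M⁻¹ i i) * z - M⁻¹ i i) * ((1 + t * M⁻¹ j j) * z' - M⁻¹ j j) *
          (M⁻¹ w w * M⁻¹ u u - M⁻¹ u w * M⁻¹ u w)) := by
  have hr : M⁻¹ w u = M⁻¹ u w := hM.inv_apply_comm w u
  have hwi : M⁻¹ w i = 0 := by rw [hM.inv_apply_comm, hiw]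
  have hui : M⁻¹ u i = 0 := by rw [hM.inv_apply_comm, hiu]
  have hji : M⁻¹ j i = 0 := by rw [hM.inv_apply_comm, hij]
  have hwj : M⁻¹ w j = 0 := by rw [hM.inv_apply_comm, hjw]
  have huj : M⁻¹ u j = 0 := by rw [hM.inv_apply_comm, hju]
  rw [← det_one_add_mul_pendant_pair]
  refine det_eq_of_eq_add_sum hM.det_pos.ne'.isUnit
    ![Pi.single i 1, Pi.single w 1, Pi.single u 1, Pi.single j 1] _ _ ?_ ?_
  · intro k l
    fin_cases k <;> fin_cases l <;> simp [*]
  · intro x y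
    simp only [Matrix.add_apply, Matrix.sub_apply, diagonal_single_apply_eq_mul,
      single_one_apply_eq_mul]
    simp [Fin.sum_univ_four]
    ring

/-- Exchanging two pendant parts, attached at `w` and `u` by their vertices `i` and `j`, decreases
the determinant if the diagonal of the inverse is not ordered consistently. -/
theorem Matrix.PosDef.det_switch_lt {M : Matrix V V ℝ} (hM : M.PosDef) {i w u j : V}
    (huw : u ≠ w) (hiw : M⁻¹ i w = 0) (hiu : M⁻¹ i u = 0) (hij : M⁻¹ i j = 0)
    (hjw : M⁻¹ j w = 0) (hju : M⁻¹ j u = 0)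
    (hlt : (M - (single w i 1 + single i w 1 + single u j 1 + single j u 1)
        + diagonal (Pi.single u 1)).det <
      (M - (single w i 1 + single i w 1 + single u j 1 + single j u 1)
        + diagonal (Pi.single w 1)).det)
    (hlt' : (M - (single w i 1 + single i w 1 + single u j 1 + single j u 1)
        + diagonal (Pi.single i 1)).det <
      (M - (single w i 1 + single i w 1 + single u j 1 + single j u 1)
        + diagonal (Pi.single j 1)).det) :
    (M - (single w j 1 + single j w 1 + single u i 1 + single i u 1)).det <
      (M - (single w i 1 + single i w 1 + single u j 1 + single j u 1)).det := by
  have hK := hM.det_pos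
  have hm := hM.inv_apply_mul_inv_apply_pos huw
  have hgi : 0 < M⁻¹ i i := hM.inv.diag_pos
  have hgj : 0 < M⁻¹ j j := hM.inv.diag_pos
  have hr : M⁻¹ w u = M⁻¹ u w := hM.inv_apply_comm w u
  have hji : M⁻¹ j i = 0 := by rw [hM.inv_apply_comm, hij]
  have hdet := hM.det_attach_pair hiw hiu hij hjw hju
  have h0 := hdet 0 0 0 0
  have h1 := hM.det_attach_pair hjw hju hji hiw hiu 0 0 0 0
  have h2 := hdet 0 0 1 0
  have h3 := hdet 0 1 0 0
  have h4 := hdet 1 0 0 0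
  have h5 := hdet 0 0 0 1
  have hz : ∀ v : V, diagonal (Pi.single v (0 : ℝ)) = 0 := fun v => by
    rw [Pi.single_zero]; exact diagonal_zero
  simp only [hz, add_zero] at h0 h1 h2 h3 h4 h5
  rw [h2, h3] at hlt
  rw [h4, h5] at hlt'
  rw [h0, h1]
  have l1 := lt_of_mul_lt_mul_left hlt hK.le
  have l2 := lt_of_mul_lt_mul_left hlt' hK.le
  refine mul_lt_mul_of_pos_left ?_ hK
  clear h0 h1 h2 h3 h4 h5 hlt hlt' hdet
  rw [hr] at hm
  generalize M⁻¹ i i = a at *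
  generalize M⁻¹ j j = b at *
  generalize M⁻¹ w w = p at *
  generalize M⁻¹ u u = q at *
  generalize M⁻¹ u w = r at *
  -- Switching changes the bracket by (a − b)(p − q). If a > b then `l2'` gives q > p; if a < b then
  -- `l1'` gives p > q; a = b contradicts the two together.
  have l1' : (b - a) * (q * p - r * r) < p - q := by linarith
  have l2' : a - b < a * b * (q - p) := by linarith
  suffices (a - b) * (p - q) < 0 by linarith
  rcases le_or_gt b a with hab | hab
  · have hqp : 0 < q - p := by
      by_contra hc
      have := mul_nonneg (mul_pos hgi hgj).le (sub_nonneg.2 (not_lt.1 (fun h => hc (sub_pos.2 h))))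
      nlinarith
    rcases hab.eq_or_lt with rfl | hab
    · linarith
    · nlinarith [mul_pos (sub_pos.2 hab) hqp]
  · have : 0 < p - q := lt_trans (mul_pos (sub_pos.2 hab) hm) l1'
    nlinarith [mul_pos (sub_pos.2 hab) this]

end RankUpdate

/-! ### Weighted matrices of trees and their inverses -/

section WeightedMatrix

open Matrix SimpleGraph

namespace GreedyTree

variable {V : Type*}

open Classical in
/-- The matrix with diagonal `y` whose off-diagonal entries are those of the negative of the
adjacency matrix of `G`. -/
noncomputable def weightedMatrix [DecidableEq V] (y : V → ℝ) (G : SimpleGraph V) : Matrix V V ℝ :=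
  diagonal y - of fun a b => if G.Adj a b then 1 else 0

/-- `G` is a tree in which every vertex `v` has degree `d v`. -/
def IsTreeRealization (d : V → ℕ) (G : SimpleGraph V) : Prop :=
  G.IsTree ∧ ∀ v, (G.neighborSet v).ncard = d v

/-- `T` is a tree realization of `d` for which the determinant of the weighted matrix is minimal. -/
def IsMinimalRealization [Fintype V] [DecidableEq V] (d : V → ℕ) (y : V → ℝ)
    (T : SimpleGraph V) : Prop :=
  IsTreeRealization d T ∧
    ∀ S, IsTreeRealization d S → (weightedMatrix y T).det ≤ (weightedMatrix y S).det

theorem ncard_neighborSet_eq_degree (G : SimpleGraph V) (v : V) [Fintype (G.neighborSet v)] :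
    (G.neighborSet v).ncard = G.degree v := by
  rw [Set.ncard_eq_toFinset_card', ← G.card_neighborFinset_eq_degree]
  rfl

variable [Fintype V]

theorem ncard_neighborSet_eq_sum (G : SimpleGraph V) [DecidableRel G.Adj] (v : V) :
    ((G.neighborSet v).ncard : ℝ) = ∑ w, if G.Adj v w then (1 : ℝ) else 0 := by
  rw [ncard_neighborSet_eq_degree, G.degree_eq_sum_if_adj]

/-- Equal degree sums give equal edge counts, so after an exchange only connectedness has to be
checked. -/
theorem isTree_of_sum_ncard_neighborSet_eq {T G : SimpleGraph V} (hT : T.IsTree)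
    (hG : G.Connected)
    (h : ∑ v, (G.neighborSet v).ncard = ∑ v, (T.neighborSet v).ncard) : G.IsTree := by
  classical
  simp only [ncard_neighborSet_eq_degree, sum_degrees_eq_twice_card_edges] at h
  have h' := (isTree_iff_connected_and_card.1 hT).2
  refine isTree_iff_connected_and_card.2 ⟨hG, ?_⟩
  rw [← h', Nat.card_eq_fintype_card, Nat.card_eq_fintype_card, ← edgeFinset_card,
    ← edgeFinset_card]
  omega

variable [DecidableEq V]

theorem weightedMatrix_eq_add_lapMatrix (y : V → ℝ) (G : SimpleGraph V) [DecidableRel G.Adj] :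
    weightedMatrix y G = diagonal (fun v => y v - (G.neighborSet v).ncard) + G.lapMatrix ℝ := by
  ext a b
  simp only [weightedMatrix, lapMatrix, degMatrix, Matrix.sub_apply, Matrix.add_apply, of_apply,
    adjMatrix_apply, diagonal_apply, ncard_neighborSet_eq_degree]
  split_ifs <;> simp

theorem posDef_weightedMatrix {y : V → ℝ} {G : SimpleGraph V}
    (h : ∀ v, ((G.neighborSet v).ncard : ℝ) < y v) : (weightedMatrix y G).PosDef := by
  classical
  rw [weightedMatrix_eq_add_lapMatrix]
  exact (PosDef.diagonal fun v => sub_pos.2 (h v)).add_posSemidef (G.posSemidef_lapMatrix ℝ)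

/-- The 0/1 diagonal matrix of the component of `a` commutes with the weighted matrix, hence with
its inverse. -/
theorem inv_weightedMatrix_apply_eq_zero {y : V → ℝ} {G : SimpleGraph V}
    (hy : ∀ v, ((G.neighborSet v).ncard : ℝ) < y v) {a b : V} (hab : ¬ G.Reachable a b) :
    (weightedMatrix y G)⁻¹ a b = 0 := by
  classical
  set M := weightedMatrix y G with hM
  have hunit : IsUnit M.det := (posDef_weightedMatrix hy).det_pos.ne'.isUnit
  let D : Matrix V V ℝ := diagonal fun v => if G.Reachable a v then 1 else 0
  have hcomm : D * M = M * D := by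
    ext v w
    simp only [D, diagonal_mul, mul_diagonal, hM, weightedMatrix, Matrix.sub_apply, of_apply,
      diagonal_apply]
    by_cases hvw : v = w
    · subst hvw; ring
    by_cases hadj : G.Adj v w
    · have : G.Reachable a v ↔ G.Reachable a w :=
        ⟨fun h => h.trans hadj.reachable, fun h => h.trans hadj.symm.reachable⟩
      simp only [this]; ring
    · simp [hvw, hadj]
  have hinv : M⁻¹ * D = D * M⁻¹ := by
    calc M⁻¹ * D = M⁻¹ * D * (M * M⁻¹) := by rw [mul_nonsing_inv _ hunit, Matrix.mul_one]
      _ = M⁻¹ * (D * M) * M⁻¹ := by simp only [Matrix.mul_assoc]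
      _ = M⁻¹ * M * (D * M⁻¹) := by rw [hcomm]; simp only [Matrix.mul_assoc]
      _ = D * M⁻¹ := by rw [nonsing_inv_mul _ hunit, Matrix.one_mul]
  have := congrFun (congrFun hinv a) b
  simp only [D, mul_diagonal, diagonal_mul, hab, Reachable.refl] at this
  simpa using this.symm

/-- The conductance of a set of vertices `R` with excess weight at least one is at most the number
of its elements. -/
theorem dotProduct_inv_weightedMatrix_mulVec_le {y : V → ℝ} {G : SimpleGraph V}
    (hy : ∀ v, ((G.neighborSet v).ncard : ℝ) < y v) (R : Finset V)
    (hR : ∀ v ∈ R, ((G.neighborSet v).ncard : ℝ) + 1 ≤ y v) :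
    (fun v => if v ∈ R then (1 : ℝ) else 0) ⬝ᵥ
      (weightedMatrix y G)⁻¹ *ᵥ (fun v => if v ∈ R then (1 : ℝ) else 0) ≤ R.card := by
  classical
  set ρ : V → ℝ := fun v => if v ∈ R then (1 : ℝ) else 0
  set M := weightedMatrix y G with hM
  have hunit : IsUnit M.det := (posDef_weightedMatrix hy).det_pos.ne'.isUnit
  set x := M⁻¹ *ᵥ ρ with hx
  have hMx : M *ᵥ x = ρ := by rw [hx, mulVec_mulVec, mul_nonsing_inv _ hunit, one_mulVec]
  have h1 : ρ ⬝ᵥ x = ∑ v ∈ R, x v := by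
    simp [ρ, dotProduct, Finset.sum_ite_mem]
  -- The right side is the quadratic form of the weighted matrix at `x`: the Laplacian part is
  -- nonnegative and the excess weights on `R` are at least one.
  have h2 : ∑ v ∈ R, x v ^ 2 ≤ ρ ⬝ᵥ x := by
    have hL := (G.posSemidef_lapMatrix ℝ).dotProduct_mulVec_nonneg x
    simp only [star_trivial] at hL
    have : ρ ⬝ᵥ x = ∑ v, (y v - (G.neighborSet v).ncard) * x v ^ 2 +
        x ⬝ᵥ G.lapMatrix ℝ *ᵥ x := by
      rw [dotProduct_comm, ← hMx, hM, weightedMatrix_eq_add_lapMatrix, add_mulVec, dotProduct_add]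
      congr 1
      simp only [dotProduct, mulVec_diagonal]
      exact Finset.sum_congr rfl fun v _ => by ring
    rw [this]
    refine le_add_of_le_of_nonneg ?_ hL
    calc ∑ v ∈ R, x v ^ 2 ≤ ∑ v ∈ R, (y v - (G.neighborSet v).ncard) * x v ^ 2 :=
          Finset.sum_le_sum fun v hv => le_mul_of_one_le_left (sq_nonneg _) (by
            linarith [hR v hv])
      _ ≤ _ := Finset.sum_le_sum_of_subset_of_nonneg (Finset.subset_univ _) fun v _ _ =>
          mul_nonneg (by linarith [hy v]) (sq_nonneg _)
  -- Combined with Σx² ≤ Σx over `R`, this yields Σx ≤ |R|.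
  have h3 : 0 ≤ ∑ v ∈ R, (x v - 1) ^ 2 := Finset.sum_nonneg fun _ _ => sq_nonneg _
  have h4 : ∑ v ∈ R, (x v - 1) ^ 2 = ∑ v ∈ R, x v ^ 2 - 2 * ∑ v ∈ R, x v + R.card := by
    rw [Finset.mul_sum, ← Finset.sum_sub_distrib, ← nsmul_one, ← Finset.sum_const,
      ← Finset.sum_add_distrib]
    exact Finset.sum_congr rfl fun v _ => by ring
  linarith

theorem weightedMatrix_add_diagonal {V : Type*} [DecidableEq V] (y z : V → ℝ)
    (G : SimpleGraph V) :
    weightedMatrix (y + z) G = weightedMatrix y G + diagonal z := by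
  have : diagonal (y + z) = diagonal y + diagonal z := (diagonal_add y z).symm
  rw [weightedMatrix, weightedMatrix, this]
  abel

theorem det_weightedMatrix_comap {W : Type*} [Fintype W] [DecidableEq W] (y : W → ℝ)
    (G : SimpleGraph V) (e : W ≃ V) :
    (weightedMatrix y (G.comap e)).det = (weightedMatrix (y ∘ e.symm) G).det := by
  rw [← det_submatrix_equiv_self e.symm]
  congr 1
  ext a b
  by_cases h : G.Adj a b <;> simp [weightedMatrix, diagonal_apply, h]

end GreedyTree

end WeightedMatrix

/-! ### Branch moves and switches in a minimal tree -/

section Exchange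

open Matrix SimpleGraph

namespace GreedyTree

variable {V : Type*}

/-- Every edge of a tree is a bridge. -/
theorem not_reachable_of_not_adj {T T₀ : SimpleGraph V} (hT : T.IsTree) (hle : T₀ ≤ T) {a b : V}
    (hab : T.Adj a b) (hab' : ¬ T₀.Adj a b) : ¬ T₀.Reachable a b := by
  intro h
  refine isBridge_iff.1 (isAcyclic_iff_forall_isBridge.1 hT.2 ((mem_edgeSet T).2 hab)) (h.mono ?_)
  intro x y hxy
  rw [deleteEdges_adj]
  refine ⟨hle hxy, fun h => hab' ?_⟩
  rcases Sym2.eq_iff.1 h with ⟨rfl, rfl⟩ | ⟨rfl, rfl⟩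
  · exact hxy
  · exact hxy.symm

theorem connected_of_forall_adj_reachable {T G : SimpleGraph V} (hT : T.Connected)
    (h : ∀ a b, T.Adj a b → G.Reachable a b) : G.Connected := by
  have := hT.nonempty
  refine ⟨fun a b => ?_⟩
  obtain ⟨p⟩ := hT.preconnected a b
  induction p with
  | nil => exact Reachable.refl _
  | cons hadj _ ih => exact (h _ _ hadj).trans ih

variable [Fintype V] [DecidableEq V] {d : V → ℕ} {y : V → ℝ} {T : SimpleGraph V}

/-- In a minimal realization, the diagonal entries of the inverse of the weighted matrix are ordered
in the opposite way to the degrees. -/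
theorem IsMinimalRealization.det_add_single_lt (hT : IsMinimalRealization d y T)
    (hdy : ∀ v, (d v : ℝ) < y v) {u w : V} (huw : u ≠ w) (hd : d w ≤ d u)
    (hy : (d u : ℝ) - d w < y u - y w) :
    (weightedMatrix (y + Pi.single u 1) T).det < (weightedMatrix (y + Pi.single w 1) T).det := by
  classical
  by_contra! hle
  obtain ⟨⟨htree, hdeg⟩, hmin⟩ := hT
  obtain ⟨p, hp⟩ := htree.1.exists_isPath u w
  have hnil : ¬ p.Nil := Walk.not_nil_of_ne huw
  -- the branches at `u` that are moved to `w`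
  obtain ⟨R, hRsub, hRcard⟩ : ∃ R ⊆ (T.neighborFinset u).erase p.snd, R.card = d u - d w := by
    refine Finset.exists_subset_card_eq ?_
    rw [Finset.card_erase_of_mem (by simpa using p.adj_snd hnil), card_neighborFinset_eq_degree,
      ← ncard_neighborSet_eq_degree, hdeg]
    -- The neighbour of `u` towards `w` stays, leaving `d u - 1` movable branches; this is enough
    -- because `d w` is positive.
    have : 0 < d w := by
      rw [← hdeg, Set.ncard_pos]
      exact ⟨_, (p.adj_penultimate hnil).symm⟩
    omega
  have hRadj : ∀ r ∈ R, T.Adj u r := fun r hr => by simpa using Finset.mem_of_mem_erase (hRsub hr)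
  have hRsnd : p.snd ∉ R := fun h => Finset.ne_of_mem_erase (hRsub h) rfl
  have huR : u ∉ R := fun h => (hRadj u h).ne rfl
  obtain ⟨T₀, hT₀⟩ : ∃ T₀ : SimpleGraph V, ∀ a b, T₀.Adj a b ↔
      T.Adj a b ∧ ¬ (a = u ∧ b ∈ R) ∧ ¬ (b = u ∧ a ∈ R) :=
    ⟨{ Adj := fun a b => T.Adj a b ∧ ¬ (a = u ∧ b ∈ R) ∧ ¬ (b = u ∧ a ∈ R)
       symm := ⟨fun a b h => ⟨h.1.symm, h.2.2, h.2.1⟩⟩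
       loopless := ⟨fun a h => h.1.ne rfl⟩ }, fun _ _ => Iff.rfl⟩
  have hle₀ : T₀ ≤ T := fun a b h => ((hT₀ a b).1 h).1
  have hreach : T₀.Reachable u w := by
    refine ⟨p.transfer T₀ fun e he => ?_⟩
    induction e with
    | h a b =>
      refine (hT₀ a b).2 ⟨p.adj_of_mem_edges he, ?_, ?_⟩
      · rintro ⟨rfl, hb⟩
        exact hRsnd (hp.eq_snd_of_mem_edges he ▸ hb)
      · rintro ⟨rfl, ha⟩
        exact hRsnd (hp.eq_snd_of_mem_edges (Sym2.eq_swap ▸ he) ▸ ha)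
  have hur : ∀ r ∈ R, ¬ T₀.Reachable u r := fun r hr =>
    not_reachable_of_not_adj htree hle₀ (hRadj r hr) fun h => ((hT₀ u r).1 h).2.1 ⟨rfl, hr⟩
  have hwr : ∀ r ∈ R, ¬ T₀.Reachable w r := fun r hr h => hur r hr (hreach.trans h)
  have hwR : w ∉ R := fun h => hwr w h (Reachable.refl _)
  obtain ⟨T₁, hT₁⟩ : ∃ T₁ : SimpleGraph V, ∀ a b, T₁.Adj a b ↔
      T₀.Adj a b ∨ (a = w ∧ b ∈ R) ∨ (b = w ∧ a ∈ R) :=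
    ⟨{ Adj := fun a b => T₀.Adj a b ∨ (a = w ∧ b ∈ R) ∨ (b = w ∧ a ∈ R)
       symm := ⟨fun a b h => h.elim (fun h => Or.inl h.symm) fun h => Or.inr h.symm⟩
       loopless := ⟨fun a h => by
         rcases h with h | ⟨rfl, h⟩ | ⟨rfl, h⟩
         · exact h.ne rfl
         · exact hwR h
         · exact hwR h⟩ }, fun _ _ => Iff.rfl⟩
  have hle₁ : T₀ ≤ T₁ := fun a b h => (hT₁ a b).2 (Or.inl h)
  let ρ : V → ℝ := fun v => if v ∈ R then 1 else 0
  have hAT : ∀ a b, (if T.Adj a b then (1 : ℝ) else 0) = (if T₀.Adj a b then 1 else 0) +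
      ((Pi.single u 1 : V → ℝ) a * ρ b + ρ a * (Pi.single u 1 : V → ℝ) b) := by
    intro a b
    by_cases h1 : a = u
    · subst h1
      by_cases h2 : b ∈ R
      · have hb : b ≠ a := fun h => huR (h ▸ h2)
        simp [hT₀, ρ, h2, hRadj b h2, hb]
      · simp [hT₀, ρ, h2, huR]
    · by_cases h2 : b = u
      · subst h2
        by_cases h3 : a ∈ R
        · simp [hT₀, ρ, h1, h3, (hRadj a h3).symm]
        · simp [hT₀, ρ, h1, h3]
      · simp [hT₀, h1, h2]
  have hAT₁ : ∀ a b, (if T₁.Adj a b then (1 : ℝ) else 0) = (if T₀.Adj a b then 1 else 0) +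
      ((Pi.single w 1 : V → ℝ) a * ρ b + ρ a * (Pi.single w 1 : V → ℝ) b) := by
    have hwadj : ∀ r ∈ R, ¬ T₀.Adj w r := fun r hr h => hwr r hr h.reachable
    intro a b
    by_cases h1 : a = w
    · subst h1
      by_cases h2 : b ∈ R
      · have hb : b ≠ a := fun h => hwR (h ▸ h2)
        simp [hT₁, ρ, h2, hwadj b h2, hb]
      · simp [hT₁, ρ, h2, hwR]
    · by_cases h2 : b = w
      · subst h2
        by_cases h3 : a ∈ R
        · simp [hT₁, ρ, h1, h3, T₀.adj_comm a b, hwadj a h3]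
        · simp [hT₁, ρ, h1, h3]
      · simp [hT₁, h1, h2]
  have hsumρ : ∑ b, ρ b = R.card := by simp [ρ]
  have hsum : ∀ v : V, ∑ b, (Pi.single v 1 : V → ℝ) b = 1 := by simp
  have hdegT : ∀ a, (d a : ℝ) = (T₀.neighborSet a).ncard +
      ((Pi.single u 1 : V → ℝ) a * R.card + ρ a) := by
    intro a
    rw [← hdeg, ncard_neighborSet_eq_sum, ncard_neighborSet_eq_sum]
    simp only [hAT, Finset.sum_add_distrib, ← Finset.mul_sum, hsum, hsumρ, mul_one]
  have hdegT₁ : ∀ a, ((T₁.neighborSet a).ncard : ℝ) = (T₀.neighborSet a).ncard +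
      ((Pi.single w 1 : V → ℝ) a * R.card + ρ a) := by
    intro a
    rw [ncard_neighborSet_eq_sum, ncard_neighborSet_eq_sum]
    simp only [hAT₁, Finset.sum_add_distrib, ← Finset.mul_sum, hsum, hsumρ, mul_one]
  have hρ : ∀ a, 0 ≤ ρ a := fun a => by simp only [ρ]; split_ifs <;> simp
  have hy₀ : ∀ v, ((T₀.neighborSet v).ncard : ℝ) < y v := by
    intro v
    have h1 : 0 ≤ (Pi.single u 1 : V → ℝ) v * R.card := by
      by_cases h : v = u <;> simp [h]
    linarith [hdegT v, hdy v, hρ v]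
  have hconn : T₁.Connected := by
    refine connected_of_forall_adj_reachable htree.1 fun a b hab => ?_
    have key : ∀ r ∈ R, T₁.Reachable u r := fun r hr =>
      (hreach.mono hle₁).trans (Adj.reachable ((hT₁ _ _).2 (Or.inr (Or.inl ⟨rfl, hr⟩))))
    by_cases h1 : a = u ∧ b ∈ R
    · exact h1.1 ▸ key b h1.2
    by_cases h2 : b = u ∧ a ∈ R
    · exact h2.1 ▸ (key a h2.2).symm
    · exact Adj.reachable (hle₁ ((hT₀ _ _).2 ⟨hab, h1, h2⟩))
  have htree₁ : T₁.IsTree := by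
    refine isTree_of_sum_ncard_neighborSet_eq htree hconn ?_
    have : (∑ v, ((T₁.neighborSet v).ncard : ℝ)) = ∑ v, ((T.neighborSet v).ncard : ℝ) := by
      simp only [hdegT₁, hdeg, hdegT, Finset.sum_add_distrib, ← Finset.sum_mul, hsum]
    exact_mod_cast this
  have hcard : (R.card : ℝ) = d u - d w := by rw [hRcard, Nat.cast_sub hd]
  -- After the move, `u` and `w` have exchanged degrees. Swapping their labels restores `d` but
  -- exchanges their weights, whence the diagonal terms ±(y u − y w) below.
  let σ := Equiv.swap u w
  have hreal : IsTreeRealization d (T₁.comap σ) := by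
    refine ⟨(Iso.isTree_iff (Iso.comap σ T₁)).2 htree₁, fun v => ?_⟩
    have h1 : ((T₁.comap σ).neighborSet v).ncard = (T₁.neighborSet (σ v)).ncard :=
      Set.ncard_preimage_of_injective_subset_range (s := T₁.neighborSet (σ v)) σ.injective
        (by simp)
    rw [h1]
    have h2 := hdegT₁ (σ v)
    have h3 := hdegT (σ v)
    have : ((T₁.neighborSet (σ v)).ncard : ℝ) = d v := by
      by_cases hv : v = u
      · subst hv
        simp only [σ, Equiv.swap_apply_left, Pi.single_eq_same,
          Pi.single_eq_of_ne huw.symm] at h2 h3 ⊢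
        linarith
      · by_cases hv' : v = w
        · subst hv'
          simp only [σ, Equiv.swap_apply_right, Pi.single_eq_same,
            Pi.single_eq_of_ne huw] at h2 h3 ⊢
          linarith
        · simp only [σ, Equiv.swap_apply_of_ne_of_ne hv hv', Pi.single_eq_of_ne hv,
            Pi.single_eq_of_ne hv'] at h2 h3 ⊢
          linarith
    exact_mod_cast this
  have hMT : weightedMatrix y T = weightedMatrix y T₀ -
      (vecMulVec (Pi.single u 1) ρ + vecMulVec ρ (Pi.single u 1)) := by
    ext a b
    simp only [weightedMatrix, Matrix.sub_apply, Matrix.add_apply, of_apply, vecMulVec_apply]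
    rw [hAT a b]; ring
  have hMT₁ : weightedMatrix (y ∘ σ.symm) T₁ = weightedMatrix y T₀ -
      (vecMulVec (Pi.single w 1) ρ + vecMulVec ρ (Pi.single w 1)) +
        diagonal (Pi.single w (y u - y w)) - diagonal (Pi.single u (y u - y w)) := by
    have hyσ : y ∘ σ.symm = y + Pi.single w (y u - y w) + Pi.single u (-(y u - y w)) := by
      ext v
      by_cases hv : v = u
      · subst hv; simp [σ, huw]
      · by_cases hv' : v = w
        · subst hv'; simp [σ, hv]
        · simp [σ, hv, hv', Equiv.swap_apply_of_ne_of_ne hv hv']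
    rw [hyσ, weightedMatrix_add_diagonal, weightedMatrix_add_diagonal]
    have hneg : diagonal (Pi.single u (-(y u - y w))) = -diagonal (Pi.single u (y u - y w)) := by
      rw [Pi.single_neg]; exact (diagonal_neg _).symm
    rw [hneg]
    ext a b
    simp only [weightedMatrix, Matrix.sub_apply, Matrix.add_apply, of_apply, vecMulVec_apply,
      Matrix.neg_apply]
    rw [hAT₁ a b]; ring
  have hzero : ∀ v, (∀ r ∈ R, ¬ T₀.Reachable v r) → ((weightedMatrix y T₀)⁻¹ *ᵥ ρ) v = 0 := by
    intro v hv
    refine Finset.sum_eq_zero fun r _ => ?_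
    by_cases hr : r ∈ R
    · simp only [inv_weightedMatrix_apply_eq_zero hy₀ (hv r hr), zero_mul]
    · simp [ρ, hr]
  -- Each branch root has lost its edge to `u`, so its excess weight exceeds one. The conductance is
  -- thus at most |R| = d u − d w, which is less than y u − y w by `hy`.
  have hcond := dotProduct_inv_weightedMatrix_mulVec_le hy₀ R fun v hv => by
    have h1 : ρ v = 1 := by simp [ρ, hv]
    have h2 : (Pi.single u 1 : V → ℝ) v = 0 := Pi.single_eq_of_ne (ne_of_mem_of_not_mem hv huR) _
    have := hdegT v
    rw [h1, h2] at this
    linarith [hdy v]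
  rw [weightedMatrix_add_diagonal, weightedMatrix_add_diagonal, hMT] at hle
  have hlt := (posDef_weightedMatrix hy₀).det_relocate_lt huw (hzero u hur) (hzero w hwr)
    (c := y u - y w) (lt_of_le_of_lt hcond (by rw [hcard]; exact hy)) hle
  rw [← hMT₁, ← hMT, ← det_weightedMatrix_comap] at hlt
  exact absurd (hmin _ hreal) (not_le.2 hlt)

/-- In a minimal realization, no path has its inner end vertices `w`, `u` and its outer end vertices
`i`, `j` ordered in opposite ways by the diagonal entries of the inverse of the weighted matrix. -/
theorem IsMinimalRealization.not_det_add_single_lt (hT : IsMinimalRealization d y T)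
    (hdy : ∀ v, (d v : ℝ) < y v) {i w u j : V} (hwu : w ≠ u) (hwi : T.Adj w i) (huj : T.Adj u j)
    {p : T.Walk w u} (hip : i ∉ p.support) (hjp : j ∉ p.support)
    (hlt : (weightedMatrix (y + Pi.single u 1) T).det < (weightedMatrix (y + Pi.single w 1) T).det) :
    ¬ (weightedMatrix (y + Pi.single i 1) T).det < (weightedMatrix (y + Pi.single j 1) T).det := by
  classical
  intro hlt'
  obtain ⟨⟨htree, hdeg⟩, hmin⟩ := hT
  have hiu : i ≠ u := fun h => hip (h ▸ p.end_mem_support)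
  have hjw : j ≠ w := fun h => hjp (h ▸ p.start_mem_support)
  obtain ⟨T₀, hT₀⟩ : ∃ T₀ : SimpleGraph V, ∀ a b, T₀.Adj a b ↔
      T.Adj a b ∧ s(a, b) ≠ s(w, i) ∧ s(a, b) ≠ s(u, j) :=
    ⟨T.deleteEdges {s(w, i), s(u, j)}, fun a b => by simp [deleteEdges_adj]⟩
  have hle₀ : T₀ ≤ T := fun a b h => ((hT₀ a b).1 h).1
  have hreach : T₀.Reachable w u := by
    refine ⟨p.transfer T₀ fun e he => ?_⟩
    induction e with
    | h a b =>
      refine (hT₀ a b).2 ⟨p.adj_of_mem_edges he, fun h => ?_, fun h => ?_⟩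
      · exact hip (p.snd_mem_support_of_mem_edges (h ▸ he))
      · exact hjp (p.snd_mem_support_of_mem_edges (h ▸ he))
  have nwi : ¬ T₀.Reachable w i :=
    not_reachable_of_not_adj htree hle₀ hwi fun h => ((hT₀ _ _).1 h).2.1 rfl
  have nuj : ¬ T₀.Reachable u j :=
    not_reachable_of_not_adj htree hle₀ huj fun h => ((hT₀ _ _).1 h).2.2 rfl
  have nui : ¬ T₀.Reachable u i := fun h => nwi (hreach.trans h)
  have nwj : ¬ T₀.Reachable w j := fun h => nuj (hreach.symm.trans h)
  have nij : ¬ T₀.Reachable i j := by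
    intro h
    -- Otherwise `w`, `u`, `j`, `i` would be linked in this order without the bridge `wi`.
    have hle₂ : T₀ ≤ T.deleteEdges {s(w, i)} := fun a b hab =>
      (deleteEdges_adj ..).2 ⟨hle₀ hab, ((hT₀ _ _).1 hab).2.1⟩
    have hadj : (T.deleteEdges {s(w, i)}).Adj u j := by
      refine (deleteEdges_adj ..).2 ⟨huj, fun h => ?_⟩
      rcases Sym2.eq_iff.1 h with h | h
      · exact hwu h.1.symm
      · exact hjw h.2
    refine not_reachable_of_not_adj htree (deleteEdges_le _) hwi (fun h => ?_)
      (((hreach.mono hle₂).trans hadj.reachable).trans (h.mono hle₂).symm)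
    exact ((deleteEdges_adj ..).1 h).2 rfl
  have hij : i ≠ j := fun h => nij (h ▸ Reachable.refl _)
  obtain ⟨T₁, hT₁⟩ : ∃ T₁ : SimpleGraph V, ∀ a b, T₁.Adj a b ↔
      T₀.Adj a b ∨ s(a, b) = s(w, j) ∨ s(a, b) = s(u, i) :=
    ⟨{ Adj := fun a b => T₀.Adj a b ∨ s(a, b) = s(w, j) ∨ s(a, b) = s(u, i)
       symm := ⟨fun a b h => by rwa [Sym2.eq_swap, T₀.adj_comm]⟩
       loopless := ⟨fun a h => by
         rcases h with h | h | h
         · exact h.ne rfl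
         · rcases Sym2.eq_iff.1 h with ⟨rfl, h'⟩ | ⟨rfl, h'⟩
           · exact hjw h'.symm
           · exact hjw h'
         · rcases Sym2.eq_iff.1 h with ⟨rfl, h'⟩ | ⟨rfl, h'⟩
           · exact hiu h'.symm
           · exact hiu h'⟩ }, fun _ _ => Iff.rfl⟩
  have hle₁ : T₀ ≤ T₁ := fun a b h => (hT₁ a b).2 (Or.inl h)
  have hwi' := hwi.symm
  have huj' := huj.symm
  have hAT : ∀ a b, (if T.Adj a b then (1 : ℝ) else 0) = (if T₀.Adj a b then 1 else 0) +
      (single w i 1 + single i w 1 + single u j 1 + single j u 1 : Matrix V V ℝ) a b := by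
    intro a b
    simp only [hT₀, Matrix.add_apply, single_apply, ne_eq, Sym2.eq_iff]
    have := hwi.ne
    have := huj.ne
    grind
  have hAT₁ : ∀ a b, (if T₁.Adj a b then (1 : ℝ) else 0) = (if T₀.Adj a b then 1 else 0) +
      (single w j 1 + single j w 1 + single u i 1 + single i u 1 : Matrix V V ℝ) a b := by
    intro a b
    have h1 : ¬ T₀.Adj w j := fun h => nwj h.reachable
    have h2 : ¬ T₀.Adj u i := fun h => nui h.reachable
    have h3 : ¬ T₀.Adj j w := fun h => nwj h.symm.reachable
    have h4 : ¬ T₀.Adj i u := fun h => nui h.symm.reachable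
    simp only [hT₁, Matrix.add_apply, single_apply, Sym2.eq_iff]
    grind
  have hsum : ∀ x z v : V, ∑ b, (single x z (1 : ℝ)) v b = (Pi.single x 1 : V → ℝ) v := by
    intro x z v
    simp only [single_one_apply_eq_mul, ← Finset.mul_sum]
    simp
  have hdegT : ∀ a, ((T.neighborSet a).ncard : ℝ) = (T₀.neighborSet a).ncard +
      ((Pi.single w 1 : V → ℝ) a + (Pi.single i 1 : V → ℝ) a + (Pi.single u 1 : V → ℝ) a +
        (Pi.single j 1 : V → ℝ) a) := by
    intro a
    rw [ncard_neighborSet_eq_sum, ncard_neighborSet_eq_sum]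
    simp only [hAT, Matrix.add_apply, Finset.sum_add_distrib, hsum]
  have hdegT₁ : ∀ a, (T₁.neighborSet a).ncard = (T.neighborSet a).ncard := by
    intro a
    have : ((T₁.neighborSet a).ncard : ℝ) = (T.neighborSet a).ncard := by
      rw [hdegT, ncard_neighborSet_eq_sum, ncard_neighborSet_eq_sum]
      simp only [hAT₁, Matrix.add_apply, Finset.sum_add_distrib, hsum]
      ring
    exact_mod_cast this
  have hy₀ : ∀ v, ((T₀.neighborSet v).ncard : ℝ) < y v := by
    intro v
    have h1 : ∀ x : V, 0 ≤ (Pi.single x 1 : V → ℝ) v := fun x => by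
      by_cases h : v = x <;> simp [h]
    have h2 := hdegT v
    rw [hdeg] at h2
    linarith [hdy v, h1 w, h1 i, h1 u, h1 j]
  have hconn : T₁.Connected := by
    have kwi : T₁.Reachable w i :=
      (hreach.mono hle₁).trans (Adj.reachable ((hT₁ _ _).2 (Or.inr (Or.inr rfl))))
    have kuj : T₁.Reachable u j :=
      (hreach.symm.mono hle₁).trans (Adj.reachable ((hT₁ _ _).2 (Or.inr (Or.inl rfl))))
    refine connected_of_forall_adj_reachable htree.1 fun a b hab => ?_
    by_cases h1 : s(a, b) = s(w, i)
    · rcases Sym2.eq_iff.1 h1 with ⟨rfl, rfl⟩ | ⟨rfl, rfl⟩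
      · exact kwi
      · exact kwi.symm
    by_cases h2 : s(a, b) = s(u, j)
    · rcases Sym2.eq_iff.1 h2 with ⟨rfl, rfl⟩ | ⟨rfl, rfl⟩
      · exact kuj
      · exact kuj.symm
    · exact Adj.reachable (hle₁ ((hT₀ _ _).2 ⟨hab, h1, h2⟩))
  have hreal : IsTreeRealization d T₁ :=
    ⟨isTree_of_sum_ncard_neighborSet_eq htree hconn (by simp only [hdegT₁]),
      fun v => by rw [hdegT₁, hdeg]⟩
  have hMT : weightedMatrix y T = weightedMatrix y T₀ -
      (single w i 1 + single i w 1 + single u j 1 + single j u 1) := by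
    ext a b
    simp only [weightedMatrix, Matrix.sub_apply, of_apply]
    rw [hAT a b]; ring
  have hMT₁ : weightedMatrix y T₁ = weightedMatrix y T₀ -
      (single w j 1 + single j w 1 + single u i 1 + single i u 1) := by
    ext a b
    simp only [weightedMatrix, Matrix.sub_apply, of_apply]
    rw [hAT₁ a b]; ring
  rw [weightedMatrix_add_diagonal, weightedMatrix_add_diagonal, hMT] at hlt hlt'
  have hzero := fun a b => inv_weightedMatrix_apply_eq_zero (G := T₀) hy₀ (a := a) (b := b)
  have := (posDef_weightedMatrix hy₀).det_switch_lt hwu.symm (hzero i w fun h => nwi h.symm)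
    (hzero i u fun h => nui h.symm) (hzero i j nij) (hzero j w fun h => nwj h.symm)
    (hzero j u fun h => nuj h.symm) hlt hlt'
  rw [← hMT, ← hMT₁] at this
  exact absurd (hmin _ hreal) (not_le.2 this)

end GreedyTree

end Exchange

/-! ### Exchange-ordered trees are greedy -/

section Structure

open SimpleGraph

namespace GreedyTree

/-- On every path, the outer end vertices are ordered in the same way as the inner ones. -/
def IsExchangeOrdered {V : Type*} [LinearOrder V] (T : SimpleGraph V) : Prop :=
  ∀ ⦃i w u j : V⦄ (p : T.Walk w u), p.IsPath → T.Adj w i → T.Adj u j → i ∉ p.support →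
    j ∉ p.support → u < w → j < i

theorem IsMinimalRealization.isExchangeOrdered {V : Type*} [Fintype V] [LinearOrder V]
    {d : V → ℕ} {y : V → ℝ} {T : SimpleGraph V} (hT : IsMinimalRealization d y T)
    (hdy : ∀ v, (d v : ℝ) < y v) (hd : Antitone d)
    (hy : ∀ u w, u < w → (d u : ℝ) - d w < y u - y w) : IsExchangeOrdered T := by
  intro i w u j p hp hwi huj hip hjp huw
  have key := fun a b (hab : a < b) => hT.det_add_single_lt hdy hab.ne (hd hab.le) (hy a b hab)
  by_contra! hij
  rcases hij.eq_or_lt with rfl | hij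
  -- A common outer vertex would close the path to a cycle.
  · have hp' : (Walk.cons hwi.symm p).IsPath := hp.cons hip
    have := hT.1.1.2.eq_snd_of_adj_start hp' huj.symm (by simp)
    exact huw.ne (by simpa using this)
  · exact hT.not_det_add_single_lt hdy huw.ne' hwi huj hip hjp (key u w huw) (key i j hij)

variable {V : Type*} [LinearOrder V] {T : SimpleGraph V}

/-- Labels decrease towards the root. Let c follow b on the way to `r` and suppose a < b. Then a has
degree at least that of b, hence at least two, and has a neighbour e off the path. Exchange order
gives e < c, while induction on the path extended to e gives c < e. -/
theorem IsExchangeOrdered.lt_of_isPath_append [Finite V] (h : IsExchangeOrdered T) (hT : T.IsTree)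
    (hdeg : Antitone fun v => (T.neighborSet v).ncard) {r : V} (hr : ∀ v, r ≤ v) {b : V}
    (q : T.Walk b r) {a : V} (p : T.Walk a b) (hpq : (p.append q).IsPath) (hab : a ≠ b) :
    b < a := by
  induction q generalizing a with
  | nil => exact lt_of_le_of_ne (hr a) hab.symm
  | @cons b c r hbc q ih =>
    by_contra! hle
    have hlt : a < b := lt_of_le_of_ne hle hab
    have hnil : ¬ p.Nil := Walk.not_nil_of_ne hab
    have hp : p.IsPath := hpq.of_append_left
    have hcp : c ∉ p.support := by
      intro hc
      rw [Walk.isPath_def, Walk.support_append, List.nodup_append] at hpq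
      exact hpq.2.2 c hc c (by simp) rfl
    have hb2 : 1 < (T.neighborSet b).ncard := by
      rw [Set.one_lt_ncard]
      exact ⟨c, hbc, p.penultimate, (p.adj_penultimate hnil).symm, fun hc =>
        hcp (hc ▸ p.getVert_mem_support _)⟩
    obtain ⟨e, he, hne⟩ : ∃ e ∈ T.neighborSet a, e ≠ (p.append (Walk.cons hbc q)).snd :=
      Set.exists_ne_of_one_lt_ncard (lt_of_lt_of_le hb2 (hdeg hlt.le)) _
    have hesupp : e ∉ (p.append (Walk.cons hbc q)).support := fun hmem =>
      hne (hT.2.eq_snd_of_adj_start hpq he hmem)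
    have hep : e ∉ p.support := fun hmem =>
      hesupp (by rw [Walk.mem_support_append_iff]; exact Or.inl hmem)
    have h1 : e < c := h p.reverse hp.reverse hbc he (by simpa using hcp) (by simpa using hep) hlt
    refine absurd (ih hr (Walk.cons (T.symm.symm _ _ he) (p.concat hbc)) ?_ ?_) h1.le.not_gt
    · rw [Walk.cons_append, Walk.concat_append]
      exact hpq.cons hesupp
    · rintro rfl
      exact hesupp (by simp)

/-- A neighbour off the path from `v` to the root has `v` on its own path to the root, so it is
larger than `v`. The smaller neighbour is therefore the parent. -/
theorem IsExchangeOrdered.eq_of_adj_of_lt [Finite V] (h : IsExchangeOrdered T) (hT : T.IsTree)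
    (hdeg : Antitone fun v => (T.neighborSet v).ncard) {r : V} (hr : ∀ v, r ≤ v) {v s t : V}
    (hs : T.Adj v s) (hsv : s < v) (ht : T.Adj v t) (htv : t < v) : s = t := by
  obtain ⟨q, hq⟩ := hT.1.exists_isPath v r
  have key : ∀ s, T.Adj v s → s < v → s = q.snd := by
    intro s hs hsv
    refine hT.2.eq_snd_of_adj_start hq hs ?_
    by_contra hmem
    exact absurd (h.lt_of_isPath_append hT hdeg hr q (Walk.cons hs.symm Walk.nil)
      (by simpa using ⟨hq, hmem⟩) hsv.ne) hsv.not_gt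
  rw [key s hs hsv, key t ht htv]

theorem IsExchangeOrdered.exists_adj_lt [Finite V] (h : IsExchangeOrdered T) (hT : T.IsTree)
    (hdeg : Antitone fun v => (T.neighborSet v).ncard) {r : V} (hr : ∀ v, r ≤ v) {v : V}
    (hv : v ≠ r) : ∃ s, T.Adj v s ∧ s < v := by
  obtain ⟨q, hq⟩ := hT.1.exists_isPath v r
  cases q with
  | nil => exact absurd rfl hv
  | cons hadj q =>
    exact ⟨_, hadj, h.lt_of_isPath_append hT hdeg hr q (Walk.cons hadj Walk.nil)
      (by simpa using hq) hadj.ne⟩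

/-- An interior local maximum of a path would have two distinct smaller neighbours. -/
theorem le_max_of_mem_support
    (huniq : ∀ ⦃v s t⦄, T.Adj v s → s < v → T.Adj v t → t < v → s = t) {w u : V}
    (p : T.Walk w u) (hp : p.IsPath) {v : V} (hv : v ∈ p.support) : v ≤ max w u := by
  induction p generalizing v with
  | nil => simp at hv; simp [hv]
  | @cons w x u hwx p ih =>
    rw [Walk.cons_isPath_iff] at hp
    rw [Walk.support_cons, List.mem_cons] at hv
    rcases hv with rfl | hv
    · exact le_max_left _ _
    refine (ih hp.1 hv).trans (max_le ?_ (le_max_right _ _))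
    by_contra! hlt
    have hwx' : w < x := (le_max_left _ _).trans_lt hlt
    have hux : u < x := (le_max_right _ _).trans_lt hlt
    have hnil : ¬ p.Nil := Walk.not_nil_of_ne hux.ne'
    have hle : p.snd ≤ x := by
      simpa [hux.le] using ih hp.1 (p.getVert_mem_support 1)
    have heq := huniq hwx.symm hwx' (p.adj_snd hnil) (lt_of_le_of_ne hle (p.adj_snd hnil).ne')
    exact hp.2 (heq ▸ p.getVert_mem_support 1)

/-- If t < s, the path from `s` to `t` stays at or below s < i < j, so it avoids `i` and `j`, and
exchange order along it gives j < i. It is enough that `t` is any neighbour of `j`. -/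
theorem IsExchangeOrdered.parent_mono [Finite V] (h : IsExchangeOrdered T) (hT : T.IsTree)
    (hdeg : Antitone fun v => (T.neighborSet v).ncard) {r : V} (hr : ∀ v, r ≤ v) {i j s t : V}
    (hij : i < j) (hs : T.Adj i s) (hsi : s < i) (ht : T.Adj j t) : s ≤ t := by
  by_contra! hts
  obtain ⟨p, hp⟩ := hT.1.exists_isPath s t
  have hmax : ∀ v ∈ p.support, v ≤ s := by
    intro v hv
    simpa [hts.le] using le_max_of_mem_support
      (fun v s t h1 h2 h3 h4 => h.eq_of_adj_of_lt hT hdeg hr h1 h2 h3 h4) p hp hv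
  exact absurd (h p hp hs.symm ht.symm (fun hi => (hmax i hi).not_gt hsi)
    (fun hj => (hmax j hj).not_gt (hsi.trans hij)) hts) hij.not_gt

theorem mem_iff_lt_card_of_isLowerSet {n : ℕ} {S : Finset (Fin n)} (hS : IsLowerSet (S : Set (Fin n)))
    (v : Fin n) : v ∈ S ↔ (v : ℕ) < S.card := by
  constructor
  · intro hv
    have : Finset.Iic v ⊆ S := fun x hx => hS (Finset.mem_Iic.1 hx) hv
    simpa using Finset.card_le_card this
  · intro hlt
    by_contra hv
    have : S ⊆ Finset.Iio v := fun x hx => Finset.mem_Iio.2 (by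
      by_contra! hle
      exact hv (hS hle hx))
    have := Finset.card_le_card this
    simp at this
    omega

/-- The root together with the vertices whose parent is below k form an initial segment, by
monotonicity of parents. Its size satisfies the recursion of `labelledCount`, so the vertices gained
from k = i to i + 1 are the labels the algorithm gives to the children of `i`. -/
theorem IsExchangeOrdered.isChild_iff {D : List ℕ} {T : SimpleGraph (Fin D.length)}
    (h : IsExchangeOrdered T) (hT : T.IsTree) (hD : D.Pairwise (· ≥ ·))
    (hdeg : ∀ i, (T.neighborSet i).ncard = D.get i) (i j : Fin D.length) :
    IsChild D i j ↔ T.Adj i j ∧ i < j := by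
  classical
  have hpos : 0 < D.length := i.pos
  let r : Fin D.length := ⟨0, hpos⟩
  have hr : ∀ v, r ≤ v := fun v => Nat.zero_le _
  have hanti : Antitone fun v => (T.neighborSet v).ncard := by
    intro a b hab
    simp only [hdeg]
    exact hD.sortedGE.antitone_get hab
  have huniq := fun v s t h1 h2 h3 h4 => h.eq_of_adj_of_lt hT hanti hr (v := v) (s := s) (t := t)
    h1 h2 h3 h4
  let S : ℕ → Finset (Fin D.length) := fun k =>
    Finset.univ.filter fun v => v = r ∨ ∃ s, T.Adj v s ∧ s < v ∧ (s : ℕ) < k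
  have hlower : ∀ k, IsLowerSet (S k : Set (Fin D.length)) := by
    intro k v x hxv hv
    simp only [S, Finset.coe_filter, Finset.mem_univ, true_and, Set.mem_ofPred_eq] at hv ⊢
    by_cases hx : x = r
    · exact Or.inl hx
    obtain ⟨s, hs, hsx⟩ := h.exists_adj_lt hT hanti hr hx
    refine Or.inr ⟨s, hs, hsx, ?_⟩
    rcases hv with rfl | ⟨t, ht, htv, htk⟩
    · exact absurd (le_antisymm hxv (hr x)) hx
    · rcases hxv.eq_or_lt with rfl | hxv
      · rwa [huniq _ _ _ hs hsx ht htv]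
      · exact lt_of_le_of_lt (h.parent_mono hT hanti hr hxv hs hsx ht) htk
  have hchildren : ∀ k : Fin D.length,
      (Finset.univ.filter fun v => T.Adj k v ∧ k < v).card = childCount D k := by
    intro k
    have h1 : (T.neighborFinset k).card = D.get k := by
      rw [← hdeg, ncard_neighborSet_eq_degree, card_neighborFinset_eq_degree]
    have h2 : (T.neighborFinset k).filter (fun v => k < v) =
        Finset.univ.filter fun v => T.Adj k v ∧ k < v := by ext; simp
    rw [← Finset.card_filter_add_card_filter_not (fun v => k < v), h2] at h1
    have hget : D.getD k 0 = D.get k := by simp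
    by_cases hk : k = r
    · have h3 : (T.neighborFinset k).filter (fun v => ¬ k < v) = ∅ := by
        rw [Finset.filter_eq_empty_iff]
        intro v hv
        rw [mem_neighborFinset] at hv
        exact not_not.2 (lt_of_le_of_ne (hk ▸ hr v) hv.ne)
      rw [h3, Finset.card_empty, add_zero] at h1
      have hk0 : (k : ℕ) = 0 := by rw [hk]
      rw [h1, ← hget, childCount, if_pos hk0, hk0]
    · obtain ⟨s, hs, hsk⟩ := h.exists_adj_lt hT hanti hr hk
      -- The unique parent accounts for the −1 in `childCount`.
      have h3 : (T.neighborFinset k).filter (fun v => ¬ k < v) = {s} := by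
        ext v
        rw [Finset.mem_filter, mem_neighborFinset, Finset.mem_singleton]
        refine ⟨fun hv => huniq _ _ _ hv.1 (lt_of_le_of_ne (not_lt.1 hv.2) hv.1.ne') hs hsk, ?_⟩
        rintro rfl
        exact ⟨hs, hsk.not_gt⟩
      rw [h3, Finset.card_singleton] at h1
      have hk0 : (k : ℕ) ≠ 0 := fun h0 => hk (Fin.ext h0)
      rw [childCount, if_neg hk0, hget, ← h1, Nat.add_sub_cancel]
  have hcard : ∀ k ≤ D.length, (S k).card = labelledCount D k := by
    intro k hk
    induction k with
    | zero =>
      have : S 0 = {r} := by ext; simp [S]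
      rw [this, labelledCount, Finset.card_singleton]
    | succ k ih =>
      have hk' : k < D.length := hk
      have hunion : S (k + 1) = S k ∪
          Finset.univ.filter fun v => T.Adj ⟨k, hk'⟩ v ∧ ⟨k, hk'⟩ < v := by
        ext v
        simp only [S, Finset.mem_union, Finset.mem_filter, Finset.mem_univ, true_and]
        constructor
        · rintro (hv | ⟨s, hs, hsv, hsk⟩)
          · exact Or.inl (Or.inl hv)
          · rcases Nat.lt_succ_iff_lt_or_eq.1 hsk with hsk | hsk
            · exact Or.inl (Or.inr ⟨s, hs, hsv, hsk⟩)
            · obtain rfl : s = ⟨k, hk'⟩ := Fin.ext hsk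
              exact Or.inr ⟨hs.symm, hsv⟩
        · rintro ((hv | ⟨s, hs, hsv, hsk⟩) | ⟨hs, hsv⟩)
          · exact Or.inl hv
          · exact Or.inr ⟨s, hs, hsv, hsk.trans k.lt_succ_self⟩
          · exact Or.inr ⟨_, hs.symm, hsv, k.lt_succ_self⟩
      have hdisj : Disjoint (S k)
          (Finset.univ.filter fun v => T.Adj ⟨k, hk'⟩ v ∧ ⟨k, hk'⟩ < v) := by
        rw [Finset.disjoint_left]
        intro v hv hv'
        simp only [S, Finset.mem_filter, Finset.mem_univ, true_and] at hv hv'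
        rcases hv with rfl | ⟨s, hs, hsv, hsk⟩
        · exact (hr _).not_gt hv'.2
        · exact hsk.ne (congrArg Fin.val (huniq _ _ _ hs hsv hv'.1.symm hv'.2))
      rw [hunion, Finset.card_union_of_disjoint hdisj, ih hk'.le, hchildren, labelledCount]
  have hmem : ∀ k ≤ D.length, ∀ v, v ∈ S k ↔ (v : ℕ) < labelledCount D k := fun k hk v => by
    rw [mem_iff_lt_card_of_isLowerSet (hlower k), hcard k hk]
  have hi := hmem i i.2.le j
  have hi' := hmem (i + 1) i.2 j
  rw [labelledCount] at hi'
  rw [IsChild, ← not_lt, ← hi, ← hi']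
  simp only [S, Finset.mem_filter, Finset.mem_univ, true_and]
  constructor
  · rintro ⟨h1, h2⟩
    push Not at h1
    rcases h2 with h2 | ⟨s, hs, hsj, hsi⟩
    · exact absurd h2 h1.1
    · obtain rfl : s = i := Fin.ext (le_antisymm (Nat.lt_succ_iff.1 hsi) (h1.2 s hs hsj))
      exact ⟨hs.symm, hsj⟩
  · rintro ⟨hadj, hlt⟩
    refine ⟨?_, Or.inr ⟨i, hadj.symm, hlt, Nat.lt_succ_self _⟩⟩
    rintro (rfl | ⟨s, hs, hsj, hsi⟩)
    · exact (hr i).not_gt hlt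
    · exact hsi.ne (congrArg Fin.val (huniq _ _ _ hs hsj hadj.symm hlt))

theorem IsExchangeOrdered.eq_greedyTree {D : List ℕ} {T : SimpleGraph (Fin D.length)}
    (h : IsExchangeOrdered T) (hT : T.IsTree) (hD : D.Pairwise (· ≥ ·))
    (hdeg : ∀ i, (T.neighborSet i).ncard = D.get i) : T = greedyTree D := by
  ext i j
  change _ ↔ i ≠ j ∧ (IsChild D i j ∨ IsChild D j i)
  rw [h.isChild_iff hT hD hdeg, h.isChild_iff hT hD hdeg]
  constructor
  · intro hadj
    exact ⟨hadj.ne, hadj.ne.lt_or_gt.imp (fun hlt => ⟨hadj, hlt⟩) fun hlt => ⟨hadj.symm, hlt⟩⟩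
  · rintro ⟨-, h | h⟩
    · exact h.1
    · exact h.1.symm

end GreedyTree

end Structure

/-! ### Minimality of the greedy tree and passage to the limit -/

section Main

open Matrix SimpleGraph Filter Topology

namespace GreedyTree

/-- Multiplicities are fibre sizes, so bijections of fibres can be glued. -/
theorem exists_equiv_of_map_univ_eq {α β γ : Type*} [Fintype α] [Fintype β] {f : α → γ} {g : β → γ}
    (h : Finset.univ.val.map f = Finset.univ.val.map g) : ∃ e : α ≃ β, ∀ a, g (e a) = f a := by
  classical
  have hfib : ∀ c, Nonempty ({a // f a = c} ≃ {b // g b = c}) := by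
    intro c
    refine ⟨Fintype.equivOfCardEq ?_⟩
    have := congrArg (Multiset.count c) h
    rw [Multiset.count_map, Multiset.count_map] at this
    rw [Fintype.card_subtype, Fintype.card_subtype]
    simpa [Finset.card_def, eq_comm] using this
  exact ⟨Equiv.ofFiberEquiv fun c => (hfib c).some, fun a => Equiv.ofFiberEquiv_map _ a⟩

theorem HasDegreeSequence.exists_equiv {V : Type*} [Fintype V] {G : SimpleGraph V}
    [DecidableRel G.Adj] {D : List ℕ} (h : HasDegreeSequence G D) :
    ∃ e : Fin D.length ≃ V, ∀ i, G.degree (e i) = D.get i := by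
  refine exists_equiv_of_map_univ_eq (f := D.get) (g := fun v => G.degree v) ?_
  rw [← h.2, Fin.univ_val_map, List.ofFn_get]

theorem isTreeRealization_comap {V : Type*} [Fintype V] {T : SimpleGraph V} [DecidableRel T.Adj]
    (hT : T.IsTree) {D : List ℕ} {e : Fin D.length ≃ V} (he : ∀ i, T.degree (e i) = D.get i) :
    IsTreeRealization D.get (T.comap e) := by
  refine ⟨(Iso.isTree_iff (Iso.comap e T)).2 hT, fun i => ?_⟩
  rw [← he, ← ncard_neighborSet_eq_degree]
  exact Set.ncard_preimage_of_injective_subset_range (s := T.neighborSet (e i)) e.injective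
    (by simp)

theorem exists_isMinimalRealization {V : Type*} [Fintype V] [DecidableEq V] {d : V → ℕ} (y : V → ℝ)
    {S : SimpleGraph V} (hS : IsTreeRealization d S) : ∃ T, IsMinimalRealization d y T := by
  obtain ⟨T, hT, hmin⟩ := Set.exists_min_image {T | IsTreeRealization d T}
    (fun T => (weightedMatrix y T).det) (Set.toFinite _) ⟨S, hS⟩
  exact ⟨T, hT, hmin⟩

/-- The greedy tree is the minimal realization for weights that are strictly decreasing. -/
theorem isMinimalRealization_greedyTree {D : List ℕ} (hD : D.Pairwise (· ≥ ·))
    {S : SimpleGraph (Fin D.length)} (hS : IsTreeRealization D.get S) {x : Fin D.length → ℝ}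
    (hx : StrictAnti x) (hpos : ∀ i, 0 < x i) :
    IsMinimalRealization D.get (fun i => D.get i + x i) (greedyTree D) := by
  obtain ⟨T, hT⟩ := exists_isMinimalRealization (fun i => D.get i + x i) hS
  have hord := hT.isExchangeOrdered (fun v => by linarith [hpos v])
    (hD.sortedGE.antitone_get) (fun u w huw => by linarith [hx huw])
  rwa [hord.eq_greedyTree hT.1.1 hD hT.1.2] at hT

theorem continuous_det_weightedMatrix {V : Type*} [Fintype V] [DecidableEq V]
    (G : SimpleGraph V) : Continuous fun y : V → ℝ => (weightedMatrix y G).det := by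
  unfold weightedMatrix
  fun_prop

theorem det_weightedMatrix_greedyTree_le {D : List ℕ} (hD : D.Pairwise (· ≥ ·))
    {S : SimpleGraph (Fin D.length)} (hS : IsTreeRealization D.get S) {t : ℝ} (ht : 0 < t) :
    (weightedMatrix (fun i => D.get i + t) (greedyTree D)).det ≤
      (weightedMatrix (fun i => D.get i + t) S).det := by
  -- Constant excess `t` is not strictly decreasing, so the minimality result does not apply
  -- directly. The added term is positive and strictly decreasing for ε > 0, and the determinants
  -- are continuous at ε = 0.
  let y : ℝ → Fin D.length → ℝ := fun ε i => D.get i + (t + ε * ((D.length : ℝ) - i))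
  have hy : Continuous y := by fun_prop
  have hy0 : y 0 = fun i => (D.get i + t : ℝ) := by simp [y]
  rw [← hy0]
  have htend : ∀ G : SimpleGraph (Fin D.length),
      Tendsto (fun ε => (weightedMatrix (y ε) G).det) (𝓝[>] 0) (𝓝 (weightedMatrix (y 0) G).det) :=
    fun G => (((continuous_det_weightedMatrix G).comp hy).tendsto 0).mono_left nhdsWithin_le_nhds
  refine le_of_tendsto_of_tendsto (htend _) (htend _) ?_
  filter_upwards [self_mem_nhdsWithin] with ε hε
  have hε : (0 : ℝ) < ε := hε
  refine (isMinimalRealization_greedyTree hD hS (x := fun i => t + ε * ((D.length : ℝ) - i))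
    ?_ ?_).2 S hS
  · intro a b hab
    have : (a : ℝ) < b := by exact_mod_cast hab
    have := mul_lt_mul_of_pos_left this hε
    simp only
    linarith
  · intro i
    have : (i : ℝ) < D.length := by exact_mod_cast i.2
    have := mul_pos hε (sub_pos.2 this)
    linarith

theorem det_diagonal_add_lapMatrix {V : Type*} [Fintype V] [DecidableEq V] (G : SimpleGraph V)
    [DecidableRel G.Adj] (t : ℝ) :
    (diagonal (fun _ => t) + G.lapMatrix ℝ).det =
      (weightedMatrix (fun v => G.degree v + t) G).det := by
  rw [weightedMatrix_eq_add_lapMatrix]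
  simp only [ncard_neighborSet_eq_degree, add_sub_cancel_left]

/-- That the greedy construction yields a tree with the right degrees needs no separate check: it
equals a minimizer for any admissible weights. -/
theorem isTreeRealization_greedyTree {D : List ℕ} (hD : D.Pairwise (· ≥ ·))
    {S : SimpleGraph (Fin D.length)} (hS : IsTreeRealization D.get S) :
    IsTreeRealization D.get (greedyTree D) := by
  refine (isMinimalRealization_greedyTree hD hS (x := fun i => (D.length : ℝ) - i) ?_ ?_).1
  · intro a b hab
    have : (a : ℝ) < b := by exact_mod_cast hab
    simp only
    linarith
  · intro i
    have : (i : ℝ) < D.length := by exact_mod_cast i.2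
    linarith

theorem laplacianEnergyLike_greedyTree_le {D : List ℕ} {V : Type*} [Fintype V] [DecidableEq V]
    {T : SimpleGraph V} [DecidableRel T.Adj] (hT : T.IsTree) (hTD : HasDegreeSequence T D) :
    laplacianEnergyLike (greedyTree D) ≤ laplacianEnergyLike T := by
  obtain ⟨e, he⟩ := hTD.exists_equiv
  have hS := isTreeRealization_comap hT he
  refine laplacianEnergyLike_le_of_det_le _ _ (Fintype.card_congr e) fun t ht => ?_
  rw [det_diagonal_add_lapMatrix, det_diagonal_add_lapMatrix]
  -- The weights in the determinants are actual degrees; `D.get` gives them for the greedy tree, and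
  -- for `T` after relabelling by `e`.
  convert det_weightedMatrix_greedyTree_le hTD.1 hS ht using 2
  · congr 1
    ext i
    rw [← ncard_neighborSet_eq_degree, (isTreeRealization_greedyTree hTD.1 hS).2]
  · rw [det_weightedMatrix_comap]
    congr 2
    ext v
    rw [Function.comp_apply, ← he, Equiv.apply_symm_apply]

end GreedyTree

end Main

theorem mainTheorem5 (D : List ℕ) (hD : GreedyTree.IsTreeDegreeSequence D) :
    (GreedyTree.greedyTree D).IsTree ∧
    GreedyTree.HasDegreeSequence (GreedyTree.greedyTree D) D ∧
    ∀ (V : Type*) [Fintype V] [DecidableEq V] (T : SimpleGraph V) [DecidableRel T.Adj],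
      T.IsTree → GreedyTree.HasDegreeSequence T D →
        GreedyTree.incidenceEnergy T = GreedyTree.laplacianEnergyLike T ∧
        GreedyTree.incidenceEnergy (GreedyTree.greedyTree D) ≤ GreedyTree.incidenceEnergy T ∧
        GreedyTree.laplacianEnergyLike (GreedyTree.greedyTree D) ≤
          GreedyTree.laplacianEnergyLike T := by
  obtain ⟨n, G, _, hG, hGD⟩ := hD
  obtain ⟨e, he⟩ := hGD.exists_equiv
  obtain ⟨htree, hdeg⟩ := GreedyTree.isTreeRealization_greedyTree hGD.1
    (GreedyTree.isTreeRealization_comap hG he)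
  refine ⟨htree, ⟨hGD.1, ?_⟩, fun V _ _ T _ hT hTD => ?_⟩
  · simp only [← GreedyTree.ncard_neighborSet_eq_degree, hdeg]
    rw [Fin.univ_val_map, List.ofFn_get]
  · have hle := GreedyTree.laplacianEnergyLike_greedyTree_le hT hTD
    have hIE := GreedyTree.incidenceEnergy_eq_laplacianEnergyLike T hT.isBipartite
    refine ⟨hIE, ?_, hle⟩
    rw [hIE, GreedyTree.incidenceEnergy_eq_laplacianEnergyLike _ htree.isBipartite]
    exact hle
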